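/- For $n\ge 1$ let $[n]=\{1,\dots,n\}$, and write $[x]_m=x(x+1)\cdots(x+m-1)$. A composition $(n_1,\dots,n_k)$ of $n$ (a sequence of positive integers with sum $n$) is encoded by the binary sequence of length $n$ whose symbols $1$ occur exactly at the places $1,\ n_1+1,\ n_1+n_2+1,\dots,\ n_1+\cdots+n_{k-1}+1$; the places are thereby distributed into $k$ ordered boxes of sizes $n_1,\dots,n_k$, each box beginning at a place where a $1$ occurs. A sequence of partition-valued processes $(\Pi_{n,\theta},\ \theta\ge 0)$, $n=1,2,\dots$, with $\Pi_{n,\theta}$ a random partition of $[n]$, is called a family of Ewens fragmentations if it has the following four properties. (Ewens distribution) For all $n\ge 1$, $\theta\ge 0$ and every partition $\pi$ of $[n]$ into $k$ blocks of sizes $n_1,\dots,n_k$, $$\mathbb P(\Pi_{n,\theta}=\pi)=\frac{\theta^{k-1}}{[\theta+1]_{n-1}}\prod_{i=1}^k (n_i-1)!\qquad(\text{where } 0^0=1).$$ (Fragmentation) For all $n\ge 1$, if $\theta>\phi\ge 0$ then $\Pi_{n,\theta}$ is a refinement of $\Pi_{n,\phi}$, that is, each block of $\Pi_{n,\phi}$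 is a union of blocks of $\Pi_{n,\theta}$. (Consistency) For all $1\le n<m$, the restriction of the process $(\Pi_{m,\theta},\ \theta\ge0)$ to $[n]$ has the same distribution, as a process, as $(\Pi_{n,\theta},\ \theta\ge0)$. (Exchangeability) For all $n\ge 1$, the law of the process $(\Pi_{n,\theta},\ \theta\ge0)$ is invariant under permutations of $[n]$. Theorem. Let $\Theta_1,\Theta_2,\dots$ be independent real random variables with $$\mathbb P(\Theta_j\le\theta)=\frac{\theta}{\theta+j-1},\qquad \theta\ge 0,\ j\ge 1,$$ where $0/0=1$ (so that $\Theta_1\le 0$ almost surely). For $n\ge1$ and $\theta\ge 0$ let $C_{n,\theta}$ be the random composition of $n$ whose binary code is the sequence of indicators $1(\Theta_j\le\theta)$, $1\le j\le n$ (on the null event $\Theta_1>\theta$ the first digit is read as $1$). For each $n$ let $\sigma_n$ be a uniformly distributed random permutation of $[n]$, independent of the process $(C_{n,\theta},\ \theta\ge 0)$. Give each place $p\in[n]$ the number $\sigma_n(p)$, and let $\Pi_{n,\theta}$ be the partition of $[n]$ whose blocks are the sets of numbers in the boxes of $C_{n,\theta}$, the order of the boxes being ignored. Then the sequence of processes $(\Pi_{n,\theta},\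 \theta\ge0)$, $n=1,2,\dots$, is a family of Ewens fragmentations. -/

import Mathlib

open MeasureTheory ProbabilityTheory
open scoped NNReal

namespace EwensFragmentation

/-- A partition of the `n`-element set `[n]` (labelled here as `0, …, n - 1`) into nonempty
blocks. In the order on this type, `π ≤ ρ` means that `π` is a refinement of `ρ`. -/
abbrev SetPartition (n : ℕ) : Type := Finpartition (Finset.univ : Finset (Fin n))

/-- The partition of `[n]` into the nonempty fibres of a function. -/
noncomputable def fibres {n : ℕ} {α : Type*} (f : Fin n → α) : SetPartition n :=
  letI : DecidableRel (Setoid.ker f).r := Classical.decRel _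
  Finpartition.ofSetoid (Setoid.ker f)

theorem mem_part_fibres {n : ℕ} {α : Type*} (f : Fin n → α) (a b : Fin n) :
    b ∈ (fibres f).part a ↔ f a = f b := by
  let : DecidableRel (Setoid.ker f).r := Classical.decRel _
  exact Finpartition.mem_part_ofSetoid_iff_rel

/-- The partition of `[n]` in which `a` and `b` are in the same block iff `f a` and `f b` are in
the same block of `π`. -/
noncomputable def pullback {n m : ℕ} (f : Fin n → Fin m) (π : SetPartition m) : SetPartition n :=
  fibres fun a => π.part (f a)

/-- The restriction to `[n]` of a partition of `[m]`, where `n ≤ m`. -/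
noncomputable def restrict {n m : ℕ} (h : n ≤ m) (π : SetPartition m) : SetPartition n :=
  pullback (Fin.castLE h) π

/-- The action of a permutation `τ` of `[n]` on partitions of `[n]`: the blocks of
`relabel τ π` are the images under `τ` of the blocks of `π`. -/
noncomputable def relabel {n : ℕ} (τ : Equiv.Perm (Fin n)) (π : SetPartition n) :
    SetPartition n :=
  pullback τ.symm π

/-- The right-hand side of the Ewens formula,
`θ ^ (k - 1) / [θ + 1]_{n - 1} * ∏ (n_i - 1)!` for a partition of `[n]` with `k` blocks of sizes
`n_i`, where `[x]_m = x (x + 1) ⋯ (x + m - 1)`. -/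
noncomputable def ewensProb {n : ℕ} (θ : ℝ≥0) (π : SetPartition n) : ℝ :=
  (θ : ℝ) ^ (π.parts.card - 1) / (ascPochhammer ℝ (n - 1)).eval ((θ : ℝ) + 1) *
    ∏ B ∈ π.parts, ((B.card - 1).factorial : ℝ)

/-- The finite set of partitions of `[n]` carries the discrete σ-algebra. -/
instance instMeasurableSpaceSetPartition (n : ℕ) : MeasurableSpace (SetPartition n) := ⊤

/-- The finite set of compositions of `n` carries the discrete σ-algebra. -/
instance instMeasurableSpaceComposition (n : ℕ) : MeasurableSpace (Composition n) := ⊤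

/-- The finite set of permutations of `[n]` carries the discrete σ-algebra. -/
instance instMeasurableSpacePerm (n : ℕ) : MeasurableSpace (Equiv.Perm (Fin n)) := ⊤

/-- A sequence of partition-valued processes `(X n θ, θ ≥ 0)`, `n = 1, 2, …`, is a family of
Ewens fragmentations. The law of a process is its law on the space of all functions
`ℝ≥0 → SetPartition n` with the product σ-algebra. -/
structure IsEwensFragmentationFamily {Ω : Type*} [MeasurableSpace Ω] (P : Measure Ω)
    (X : (n : ℕ) → ℝ≥0 → Ω → SetPartition n) : Prop where
  /-- Every `X n θ` is a random partition. -/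
  measurable : ∀ n, 1 ≤ n → ∀ θ, Measurable (X n θ)
  /-- Ewens distribution. -/
  ewens : ∀ n, 1 ≤ n → ∀ θ, ∀ π : SetPartition n, P.real {ω | X n θ ω = π} = ewensProb θ π
  /-- Fragmentation: `X n θ` is a refinement of `X n φ` if `θ > φ`. -/
  fragmentation : ∀ n, 1 ≤ n → ∀ φ θ, φ < θ → ∀ ω, X n θ ω ≤ X n φ ω
  /-- Consistency. -/
  consistency : ∀ n m, 1 ≤ n → ∀ h : n < m,
    IdentDistrib (fun ω θ => restrict h.le (X m θ ω)) (fun ω θ => X n θ ω) P P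
  /-- Exchangeability. -/
  exchangeability : ∀ n, 1 ≤ n → ∀ τ : Equiv.Perm (Fin n),
    IdentDistrib (fun ω θ => relabel τ (X n θ ω)) (fun ω θ => X n θ ω) P P

/-- The binary code of a composition `(n_1, …, n_k)` of `n`: the concatenation of `k` strings of
the form `1`, `10`, `100`, … of lengths `n_1, …, n_k`. In terms of places counted from `0`, the
symbol `1` occurs at the places `0, n_1, n_1 + n_2, …, n_1 + ⋯ + n_{k-1}`, which are the elements
of `c.boundaries` other than `n`. -/
def binaryCode {n : ℕ} (c : Composition n) (i : Fin n) : Bool :=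
  decide (i.castSucc ∈ c.boundaries)

/-- The composition of `n` with a given binary code `x`. (A binary code starts with `1`; the first
digit of `x` is read as `1` in any case.) -/
def ofBinaryCode {n : ℕ} (x : Fin n → Bool) : Composition n :=
  CompositionAsSet.toComposition
    { boundaries := insert 0 (insert (Fin.last n)
        ((Finset.univ.filter fun i => x i = true).image Fin.castSucc))
      zero_mem := by simp
      getLast_mem := by simp }

/-- The composition `ofBinaryCode x` has the binary code `x`. -/
theorem binaryCode_ofBinaryCode {n : ℕ} (x : Fin n → Bool)
    (hx : ∀ i : Fin n, (i : ℕ) = 0 → x i = true) : binaryCode (ofBinaryCode x) = x := by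
  funext i
  have h0 : i.castSucc = 0 ↔ (i : ℕ) = 0 := by simp [Fin.ext_iff]
  rw [binaryCode, ofBinaryCode, CompositionAsSet.toComposition_boundaries, Bool.eq_iff_iff]
  simp only [decide_eq_true_eq, Finset.mem_insert, Finset.mem_image, Finset.mem_filter,
    Finset.mem_univ, true_and, h0]
  constructor
  · rintro (h | h | ⟨j, hj, h⟩)
    · exact hx i h
    · exact absurd h (Fin.castSucc_lt_last i).ne
    · rwa [← Fin.castSucc_injective n h]
  · exact fun h => Or.inr (Or.inr ⟨i, h, rfl⟩)

/-- The composition `C_{n,θ}` of `n` whose binary code is the sequence of indicators of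
`t_j ≤ θ`, `1 ≤ j ≤ n`, for a sequence `t_1, t_2, …` of real numbers. -/
noncomputable def indicatorComposition (n : ℕ) (θ : ℝ≥0) (t : ℕ+ → ℝ) : Composition n :=
  ofBinaryCode fun i : Fin n => decide (t (Nat.succPNat i) ≤ θ)

/-- The partition of `[n]` obtained from a composition `c` of `n` when the place `p` (a ball in
one of the ordered boxes of `c`) is given the number `σ p`, and the order of the boxes is
forgotten: the blocks are the sets of numbers in the boxes. Here `c.index p` is the box that
contains the place `p`. -/
noncomputable def associatedPartition {n : ℕ} (c : Composition n) (σ : Equiv.Perm (Fin n)) :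
    SetPartition n :=
  fibres fun a => c.index (σ.symm a)

end EwensFragmentation

/-!
The law of the process of `[n]` is a function of two independent inputs: a uniform numbering of
the places, and the marks `max Θ_j 0`, whose law on `ℝ` is determined by the tails
`P(Θ_j > x) = (j - 1) / (x + j - 1)` for `x ≥ 0` (`fragmentationLaw`). Refinement is immediate, as
the codes increase with the level, and exchangeability is the invariance of the uniform law under
left multiplication (`map_relabel_fragmentationLaw`).

*Consistency.* To restrict from `[n + 1]` to `[n]`, remove the place `p` of the number `n + 1`,
which is uniform and independent of the numbering of the other places. If a box begins at `p`, then
afterwards a box begins at the next place, at every level at once; so the mark of `p` is merged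
with the next mark, if there is one, by taking the minimum
(`restrict_thresholdPartition_insertPlace`). Writing `a_i`
for the tail at the place `i`, counted from `0`, one has
`a_i a_{i+1} = (i + 1) a_i - i a_{i+1}` (`markTail_mul_markTail_succ`). Therefore the sum over `p`
of the probabilities of a product of half-lines telescopes, and the merged marks, averaged over
`p`, have the law of the marks of `n` places (`sum_map_mergeAt`). This identity holds for the marks
themselves, hence for the whole process (`map_restrict_fragmentationLaw`).

*Ewens distribution.* At a fixed level the stronger statement holds that the number at the last
place is uniform and independent of the partition (`lastPlaceSum_eq`). It is proved by induction,
removing the last place: by symmetry its number may be taken to be the largest one. If that number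
is alone in its block, the last symbol is `1`; otherwise the symbol is `0`, and the number at the
preceding place is one of the other elements of its block (`associatedPartition_snoc_eq_iff`). The
resulting recursion is that of the Chinese restaurant process, which the Ewens formula satisfies
(`ewensProb_succ`).
-/

namespace EwensFragmentation

/-! ### Partitions into fibres -/

theorem mem_part_iff_part_eq {n : ℕ} (π : SetPartition n) (a b : Fin n) :
    b ∈ π.part a ↔ π.part a = π.part b :=
  (π.mem_part_iff_part_eq_part (Finset.mem_univ b) (Finset.mem_univ a)).trans eq_comm

theorem parts_eq_image_part {n : ℕ} (π : SetPartition n) :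
    π.parts = Finset.univ.image π.part := by
  ext B
  simp only [Finset.mem_image, Finset.mem_univ, true_and]
  constructor
  · intro hB
    obtain ⟨a, ha⟩ := π.nonempty_of_mem_parts hB
    exact ⟨a, π.part_eq_of_mem hB ha⟩
  · rintro ⟨a, rfl⟩
    exact π.part_mem.2 (Finset.mem_univ a)

theorem setPartition_ext {n : ℕ} {π ρ : SetPartition n}
    (h : ∀ a b, b ∈ π.part a ↔ b ∈ ρ.part a) : π = ρ := by
  have : π.part = ρ.part := funext fun a => Finset.ext (h a)
  ext1
  rw [parts_eq_image_part, parts_eq_image_part, this]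

theorem fibres_le {n : ℕ} {α β : Type*} {f : Fin n → α} {g : Fin n → β}
    (h : ∀ a b, f a = f b → g a = g b) : fibres f ≤ fibres g := by
  intro B hB
  rw [parts_eq_image_part] at hB
  obtain ⟨a, -, rfl⟩ := Finset.mem_image.1 hB
  refine ⟨(fibres g).part a, (fibres g).part_mem.2 (Finset.mem_univ a), fun b hb => ?_⟩
  exact (mem_part_fibres g a b).2 (h a b ((mem_part_fibres f a b).1 hb))

theorem mem_part_pullback {n m : ℕ} (f : Fin n → Fin m) (π : SetPartition m) (a b : Fin n) :
    b ∈ (pullback f π).part a ↔ f b ∈ π.part (f a) := by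
  rw [pullback, mem_part_fibres, mem_part_iff_part_eq]

theorem restrict_restrict {n m l : ℕ} (h : n ≤ m) (h' : m ≤ l) (π : SetPartition l) :
    restrict h (restrict h' π) = restrict (h.trans h') π :=
  setPartition_ext fun a b => by
    simp only [restrict, mem_part_pullback]
    rfl

theorem mem_part_restrict_succ {n : ℕ} (h : n ≤ n + 1) (π : SetPartition (n + 1)) (a b : Fin n) :
    b ∈ (restrict h π).part a ↔ b.castSucc ∈ π.part a.castSucc :=
  mem_part_pullback _ π a b

/-! ### Boxes in terms of the binary code -/

theorem index_eq_index_iff {n : ℕ} (c : Composition n) {i j : Fin n} (hij : i ≤ j) :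
    c.index i = c.index j ↔ ∀ k, i < k → k ≤ j → k.castSucc ∉ c.boundaries := by
  have hlow : ∀ i : Fin n, c.sizeUpTo (c.index i) ≤ i := c.sizeUpTo_index_le
  have hup : ∀ i : Fin n, (i : ℕ) < c.sizeUpTo (c.index i + 1) := c.lt_sizeUpTo_index_succ
  constructor
  · intro h k hik hkj hk
    obtain ⟨m, -, hm⟩ := Finset.mem_map.1 hk
    have hm' : c.sizeUpTo m = k := congrArg Fin.val hm
    have h1 : (c.index i : ℕ) < m := by
      by_contra! hcon
      have := c.monotone_sizeUpTo hcon
      have := hlow i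
      omega
    have h2 : (m : ℕ) < c.index j + 1 := by
      by_contra! hcon
      have := c.monotone_sizeUpTo hcon
      have := hup j
      omega
    rw [h] at h1
    omega
  · intro h
    rcases lt_trichotomy (c.index i) (c.index j) with hlt | heq | hgt
    · exfalso
      have h1 := c.monotone_sizeUpTo (Nat.succ_le_of_lt (Fin.lt_def.1 hlt))
      have h2 := hup i
      have h3 := hlow j
      refine h ⟨c.sizeUpTo (c.index j), by omega⟩ ?_ ?_ ?_
      · exact Fin.lt_def.2 (by simpa using h2.trans_le h1)
      · exact Fin.le_def.2 h3
      · exact Finset.mem_map.2 ⟨(c.index j).castSucc, Finset.mem_univ _, Fin.ext rfl⟩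
    · exact heq
    · have h1 := c.monotone_sizeUpTo (Nat.succ_le_of_lt (Fin.lt_def.1 hgt))
      have h2 := hup j
      have h3 := hlow i
      have h4 := Fin.le_def.1 hij
      simp only [Nat.succ_eq_add_one] at h1
      omega

/-- The places `i` and `j` are in the same box of the composition with binary code `x`: the symbol
`1` does not occur after the smaller place, up to and including the larger one. -/
def SameBox {n : ℕ} (x : Fin n → Bool) (i j : Fin n) : Prop :=
  ∀ k, min i j < k → k ≤ max i j → x k = false

theorem index_ofBinaryCode_eq_iff {n : ℕ} (x : Fin n → Bool) (i j : Fin n) :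
    (ofBinaryCode x).index i = (ofBinaryCode x).index j ↔ SameBox x i j := by
  wlog hij : i ≤ j generalizing i j
  · rw [eq_comm, this j i (le_of_not_ge hij), SameBox, SameBox, min_comm, max_comm]
  rw [index_eq_index_iff _ hij, SameBox, min_eq_left hij, max_eq_right hij]
  refine forall_congr' fun k => imp_congr_right fun hik => imp_congr_right fun _ => ?_
  rw [ofBinaryCode, CompositionAsSet.toComposition_boundaries]
  have h0 : k.castSucc ≠ 0 := fun h => by
    have := Fin.lt_def.1 hik
    have := congrArg Fin.val h
    simp at this
    omega
  simp [h0, (Fin.castSucc_lt_last k).ne]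

theorem mem_part_associatedPartition {n : ℕ} (x : Fin n → Bool) (σ : Equiv.Perm (Fin n))
    (a b : Fin n) :
    b ∈ (associatedPartition (ofBinaryCode x) σ).part a ↔ SameBox x (σ.symm a) (σ.symm b) := by
  rw [associatedPartition, mem_part_fibres, index_ofBinaryCode_eq_iff]

theorem relabel_associatedPartition {n : ℕ} (τ σ : Equiv.Perm (Fin n)) (c : Composition n) :
    relabel τ (associatedPartition c σ) = associatedPartition c (τ * σ) :=
  setPartition_ext fun a b => by
    simp only [relabel, mem_part_pullback, associatedPartition, mem_part_fibres]
    rfl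

theorem associatedPartition_mono {n : ℕ} {x y : Fin n → Bool} (h : ∀ i, x i = true → y i = true)
    (σ : Equiv.Perm (Fin n)) :
    associatedPartition (ofBinaryCode y) σ ≤ associatedPartition (ofBinaryCode x) σ := by
  refine fibres_le fun a b => ?_
  simp only [index_ofBinaryCode_eq_iff, SameBox]
  intro hy k h1 h2
  have := hy k h1 h2
  have := h k
  grind

/-! ### Removing the place of the largest number -/

/-- The numbering of `n + 1` places that gives the place `p` the largest number and numbers the
remaining places, in their order, as the numbering `τ` of `n` places does. -/
def insertPlace {n : ℕ} (p : Fin (n + 1)) (τ : Equiv.Perm (Fin n)) : Equiv.Perm (Fin (n + 1)) :=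
  ((finSuccEquiv' p).trans (Equiv.optionCongr τ)).trans (finSuccEquiv' (Fin.last n)).symm

@[simp]
theorem insertPlace_self {n : ℕ} (p : Fin (n + 1)) (τ : Equiv.Perm (Fin n)) :
    insertPlace p τ p = Fin.last n := by
  simp [insertPlace]

@[simp]
theorem insertPlace_succAbove {n : ℕ} (p : Fin (n + 1)) (τ : Equiv.Perm (Fin n)) (q : Fin n) :
    insertPlace p τ (p.succAbove q) = (τ q).castSucc := by
  simp [insertPlace]

@[simp]
theorem insertPlace_symm_last {n : ℕ} (p : Fin (n + 1)) (τ : Equiv.Perm (Fin n)) :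
    (insertPlace p τ).symm (Fin.last n) = p := by
  rw [Equiv.symm_apply_eq, insertPlace_self]

@[simp]
theorem insertPlace_symm_castSucc {n : ℕ} (p : Fin (n + 1)) (τ : Equiv.Perm (Fin n)) (a : Fin n) :
    (insertPlace p τ).symm a.castSucc = p.succAbove (τ.symm a) := by
  rw [Equiv.symm_apply_eq, insertPlace_succAbove, Equiv.apply_symm_apply]

theorem insertPlace_bijective (n : ℕ) :
    Function.Bijective fun q : Fin (n + 1) × Equiv.Perm (Fin n) => insertPlace q.1 q.2 := by
  rw [Fintype.bijective_iff_injective_and_card]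
  constructor
  · rintro ⟨p, τ⟩ ⟨p', τ'⟩ h
    simp only at h
    obtain rfl : p = p' := by
      rw [← insertPlace_symm_last p τ, h, insertPlace_symm_last]
    refine Prod.ext rfl (Equiv.ext fun q => Fin.castSucc_injective n ?_)
    simp only
    rw [← insertPlace_succAbove p τ, h, insertPlace_succAbove]
  · simp [Fintype.card_perm, Nat.factorial_succ]

theorem sum_perm_succ {n : ℕ} {M : Type*} [AddCommMonoid M] (f : Equiv.Perm (Fin (n + 1)) → M) :
    ∑ σ, f σ = ∑ p, ∑ τ, f (insertPlace p τ) := by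
  rw [← Fintype.sum_prod_type', ← Function.Bijective.sum_comp (insertPlace_bijective n) f]

/-- When the place `p` is removed, a mark at `p` is passed on to the next place, if there is one:
the marks of the places `p` and `p + 1` are merged by `min`. -/
def mergeAt {n : ℕ} {α : Type*} [Min α] (p : Fin (n + 1)) (t : Fin (n + 1) → α) (q : Fin n) : α :=
  if q.castSucc < p then t q.castSucc
  else if q.castSucc = p then min (t q.castSucc) (t q.succ) else t q.succ

/-- The partition of `[n]` determined by the marks `t` at level `θ`, for the numbering `σ` of the
places. -/
noncomputable def thresholdPartition {n : ℕ} (σ : Equiv.Perm (Fin n)) (t : Fin n → ℝ) (θ : ℝ≥0) :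
    SetPartition n :=
  associatedPartition (ofBinaryCode fun i => decide (t i ≤ θ)) σ

theorem sameBox_mergeAt {n : ℕ} (p : Fin (n + 1)) (t : Fin (n + 1) → ℝ) (θ : ℝ) (i j : Fin n) :
    SameBox (fun k => decide (mergeAt p t k ≤ θ)) i j ↔
      SameBox (fun k => decide (t k ≤ θ)) (p.succAbove i) (p.succAbove j) := by
  wlog hij : i ≤ j generalizing i j
  · have := this j i (le_of_not_ge hij)
    simpa only [SameBox, min_comm, max_comm] using this
  have hij' : p.succAbove i ≤ p.succAbove j := Fin.succAbove_le_succAbove_iff.2 hij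
  simp only [SameBox, min_eq_left hij, max_eq_right hij, min_eq_left hij', max_eq_right hij',
    decide_eq_false_iff_not, not_le]
  have hi : (p.succAbove i : ℕ) = if (i : ℕ) < p then (i : ℕ) else i + 1 := by
    simp only [Fin.succAbove, Fin.lt_def, Fin.val_castSucc]; split_ifs <;> simp
  have hj : (p.succAbove j : ℕ) = if (j : ℕ) < p then (j : ℕ) else j + 1 := by
    simp only [Fin.succAbove, Fin.lt_def, Fin.val_castSucc]; split_ifs <;> simp
  simp only [Fin.lt_def, Fin.le_def, hi, hj]
  constructor
  · intro h k hk1 hk2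
    by_cases hkp : (k : ℕ) ≤ p ∧ (k : ℕ) < n
    · -- a mark at a place up to `p` survives at the same place
      have := h ⟨k, hkp.2⟩ (by simp only; split_ifs at hk1 <;> omega)
        (by simp only; split_ifs at hk2 <;> omega)
      simp only [mergeAt, Fin.lt_def, Fin.ext_iff, Fin.val_castSucc] at this
      split_ifs at this with h1 h2
      · exact this
      · exact (lt_min_iff.1 this).1
      · omega
    · -- a mark at a later place moves one place to the left
      have hk := k.isLt
      have hj := j.isLt
      have hkp' : (p : ℕ) < k := by split_ifs at hk2 <;> omega
      have := h ⟨k - 1, by omega⟩ (by simp only; split_ifs at hk1 <;> omega)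
        (by simp only; split_ifs at hk2 <;> omega)
      have hs : (⟨k - 1, by omega⟩ : Fin n).succ = k := Fin.ext (by simp; omega)
      simp only [mergeAt, Fin.lt_def, Fin.ext_iff, Fin.val_castSucc, hs] at this
      split_ifs at this with h1 h2
      · omega
      · exact (lt_min_iff.1 this).2
      · exact this
  · intro h k hk1 hk2
    simp only [mergeAt, Fin.lt_def, Fin.ext_iff, Fin.val_castSucc]
    split_ifs with h1 h2
    · exact h _ (by simp only [Fin.val_castSucc]; split_ifs <;> omega)
        (by simp only [Fin.val_castSucc]; split_ifs <;> omega)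
    · exact lt_min (h _ (by simp only [Fin.val_castSucc]; split_ifs <;> omega)
        (by simp only [Fin.val_castSucc]; split_ifs <;> omega))
        (h _ (by simp only [Fin.val_succ]; split_ifs <;> omega)
        (by simp only [Fin.val_succ]; split_ifs <;> omega))
    · exact h _ (by simp only [Fin.val_succ]; split_ifs <;> omega)
        (by simp only [Fin.val_succ]; split_ifs <;> omega)

theorem restrict_thresholdPartition_insertPlace {n : ℕ} (h : n ≤ n + 1) (p : Fin (n + 1))
    (τ : Equiv.Perm (Fin n)) (t : Fin (n + 1) → ℝ) (θ : ℝ≥0) :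
    restrict h (thresholdPartition (insertPlace p τ) t θ) =
      thresholdPartition τ (mergeAt p t) θ :=
  setPartition_ext fun a b => by
    simp only [mem_part_restrict_succ, thresholdPartition, mem_part_associatedPartition,
      insertPlace_symm_castSucc, sameBox_mergeAt]

/-! ### The Ewens formula as a product over elements -/

/-- The number of smaller elements in the block of `a`. -/
def rankInBlock {n : ℕ} (π : SetPartition n) (a : Fin n) : ℕ :=
  (Finset.univ.filter fun b => b < a ∧ b ∈ π.part a).card

/-- The factor contributed by `a` when `π` is built by adding the elements in increasing order, as
in the Chinese restaurant process: the size of the block that `a` joins, or `θ` if `a` opens a new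
block, except for the very first element. -/
noncomputable def seatingWeight {n : ℕ} (θ : ℝ≥0) (π : SetPartition n) (a : Fin n) : ℝ :=
  if rankInBlock π a = 0 then (if (a : ℕ) = 0 then 1 else θ) else rankInBlock π a

theorem prod_card_filter_lt {n : ℕ} {M : Type*} [CommMonoid M] (g : ℕ → M)
    (B : Finset (Fin n)) : ∏ a ∈ B, g (B.filter (· < a)).card = ∏ i ∈ Finset.range B.card, g i := by
  induction B using Finset.induction_on_max with
  | empty => simp
  | insert a s hs ih =>
    have ha : a ∉ s := fun h => lt_irrefl a (hs a h)
    rw [Finset.prod_insert ha, Finset.card_insert_of_notMem ha, Finset.prod_range_succ, ← ih,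
      mul_comm]
    congr 1
    · refine Finset.prod_congr rfl fun x hx => ?_
      rw [Finset.filter_insert, if_neg (hs x hx).not_gt]
    · rw [Finset.filter_insert, if_neg (lt_irrefl a), Finset.filter_true_of_mem hs]

theorem prod_seatingWeight_block {n : ℕ} (θ : ℝ≥0) (π : SetPartition (n + 1))
    {B : Finset (Fin (n + 1))} (hB : B ∈ π.parts) :
    ∏ a ∈ B, seatingWeight θ π a = (if 0 ∈ B then 1 else (θ : ℝ)) * (B.card - 1).factorial := by
  have key : ∀ a ∈ B, seatingWeight θ π a =
      (fun i : ℕ => if i = 0 then (if 0 ∈ B then 1 else (θ : ℝ)) else (i : ℝ))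
        (B.filter (· < a)).card := by
    intro a ha
    have hr : rankInBlock π a = (B.filter (· < a)).card := by
      rw [rankInBlock, π.part_eq_of_mem hB ha]
      congr 1
      ext b
      simp [and_comm]
    simp only [seatingWeight, hr]
    split_ifs with h0 h1 h2 h2
    · rfl
    · exact absurd (by rwa [Fin.ext (a := a) (b := 0) h1] at ha) h2
    · exfalso
      rw [Finset.card_eq_zero] at h0
      have : (0 : Fin (n + 1)) ∈ B.filter (· < a) :=
        Finset.mem_filter.2 ⟨h2, Fin.lt_def.2 (Nat.pos_of_ne_zero h1)⟩
      simp [h0] at this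
    · rfl
    · rfl
  rw [Finset.prod_congr rfl key, prod_card_filter_lt
    (fun i : ℕ => if i = 0 then (if 0 ∈ B then 1 else (θ : ℝ)) else (i : ℝ))]
  obtain ⟨m, hm⟩ : ∃ m, B.card = m + 1 :=
    Nat.exists_eq_succ_of_ne_zero (Finset.card_pos.2 (π.nonempty_of_mem_parts hB)).ne'
  rw [hm, Finset.prod_range_succ', mul_comm, Nat.add_sub_cancel,
    ← Finset.prod_range_add_one_eq_factorial]
  push_cast
  simp

/-- The factor `1` of the first element accounts for the exponent `k - 1` of `θ` in the Ewens
formula, also at `θ = 0`. -/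
theorem ewensProb_eq_prod {n : ℕ} (θ : ℝ≥0) (π : SetPartition (n + 1)) :
    ewensProb θ π =
      (∏ a, seatingWeight θ π a) / (ascPochhammer ℝ n).eval ((θ : ℝ) + 1) := by
  have h1 : ∏ a, seatingWeight θ π a = ∏ B ∈ π.parts, ∏ a ∈ B, seatingWeight θ π a := by
    conv_lhs => rw [← π.biUnion_parts]
    exact Finset.prod_biUnion π.disjoint
  have h2 : (π.parts.filter fun B => 0 ∉ B) = π.parts.erase (π.part 0) := by
    ext B
    simp only [Finset.mem_filter, Finset.mem_erase]
    constructor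
    · rintro ⟨hB, h0⟩
      exact ⟨fun h => h0 (h ▸ π.mem_part (Finset.mem_univ 0)), hB⟩
    · rintro ⟨hne, hB⟩
      exact ⟨hB, fun h0 => hne (π.part_eq_of_mem hB h0).symm⟩
  rw [h1, Finset.prod_congr rfl fun B hB => prod_seatingWeight_block θ π hB,
    Finset.prod_mul_distrib, Finset.prod_ite, Finset.prod_const_one, one_mul, Finset.prod_const,
    h2, Finset.card_erase_of_mem (π.part_mem.2 (Finset.mem_univ 0)), ewensProb,
    Nat.add_sub_cancel]
  ring

theorem ewensProb_one (θ : ℝ≥0) (π : SetPartition 1) : ewensProb θ π = 1 := by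
  rw [ewensProb_eq_prod (n := 0)]
  have : rankInBlock π 0 = 0 := by
    simp [rankInBlock]
  simp [seatingWeight, this]

theorem ewensProb_succ {n : ℕ} (θ : ℝ≥0) (h : n + 1 ≤ n + 1 + 1) (π : SetPartition (n + 1 + 1)) :
    ewensProb θ π = ewensProb θ (restrict h π) *
      ((if rankInBlock π (Fin.last _) = 0 then (θ : ℝ) else rankInBlock π (Fin.last _)) /
        (θ + (n + 1))) := by
  have hr : ∀ a : Fin (n + 1), rankInBlock π a.castSucc = rankInBlock (restrict h π) a := by
    intro a
    rw [rankInBlock, rankInBlock, ← Finset.card_map (Fin.castSuccEmb (n := n + 1))]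
    congr 1
    ext b
    simp only [Finset.mem_filter, Finset.mem_univ, true_and, Finset.mem_map,
      mem_part_restrict_succ, Fin.coe_castSuccEmb]
    constructor
    · rintro ⟨hlt, hb⟩
      refine ⟨b.castPred (hlt.trans (Fin.castSucc_lt_last a)).ne, ?_, ?_⟩
      · exact ⟨Fin.castPred_lt_iff _ |>.2 hlt, by simpa using hb⟩
      · simp
    · rintro ⟨b, ⟨hlt, hb⟩, rfl⟩
      exact ⟨by simpa using hlt, hb⟩
  rw [ewensProb_eq_prod, ewensProb_eq_prod, Fin.prod_univ_castSucc, ascPochhammer_succ_eval]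
  have hs : ∀ a : Fin (n + 1), seatingWeight θ π a.castSucc = seatingWeight θ (restrict h π) a := by
    intro a
    simp only [seatingWeight, hr, Fin.val_castSucc]
  have hl : seatingWeight θ π (Fin.last _) = if rankInBlock π (Fin.last _) = 0 then (θ : ℝ)
      else rankInBlock π (Fin.last _) := by
    simp [seatingWeight]
  rw [hl, Finset.prod_congr rfl fun a _ => hs a, div_mul_div_comm]
  congr 2
  ring

theorem relabel_injective {n : ℕ} (τ : Equiv.Perm (Fin n)) : Function.Injective (relabel τ) := by
  intro π ρ h
  refine setPartition_ext fun a b => ?_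
  have : τ b ∈ (relabel τ π).part (τ a) ↔ τ b ∈ (relabel τ ρ).part (τ a) := by rw [h]
  simpa [relabel, mem_part_pullback] using this

theorem ewensProb_relabel {n : ℕ} (θ : ℝ≥0) (τ : Equiv.Perm (Fin n)) (π : SetPartition n) :
    ewensProb θ (relabel τ π) = ewensProb θ π := by
  have hpart : ∀ a, (relabel τ π).part a = (π.part (τ.symm a)).map τ.toEmbedding := by
    intro a
    ext b
    simp [relabel, mem_part_pullback, Finset.mem_map_equiv]
  have hparts : (relabel τ π).parts =
      π.parts.map (Finset.mapEmbedding τ.toEmbedding).toEmbedding := by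
    rw [parts_eq_image_part, parts_eq_image_part]
    ext B
    simp only [Finset.mem_image, Finset.mem_univ, true_and, Finset.mem_map, hpart]
    constructor
    · rintro ⟨a, rfl⟩
      exact ⟨_, ⟨τ.symm a, rfl⟩, rfl⟩
    · rintro ⟨_, ⟨a, rfl⟩, rfl⟩
      exact ⟨τ a, by simp [Finset.mapEmbedding_apply]⟩
  simp [ewensProb, hparts, Finset.mapEmbedding_apply]

/-! ### The joint law of the partition and the number at the last place -/

/-- The probability that the symbol `b` occurs at the place `i`, counted from `0`. -/
noncomputable def codeWeight (θ : ℝ≥0) (i : ℕ) (b : Bool) : ℝ :=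
  if b then (if (θ : ℝ) + i = 0 then 1 else θ / (θ + i)) else i / (θ + i)

theorem codeWeight_zero (θ : ℝ≥0) (b : Bool) : codeWeight θ 0 b = if b then 1 else 0 := by
  by_cases h : (θ : ℝ) = 0 <;> simp [codeWeight, h]

/-- `(n + 1)!` times the probability that the partition at level `θ` is `π` and the last place has
the number `a`, as a sum over the numberings of the places and the binary codes. -/
noncomputable def lastPlaceSum {n : ℕ} (θ : ℝ≥0) (π : SetPartition (n + 1)) (a : Fin (n + 1)) : ℝ :=
  open Classical in
  ∑ σ : Equiv.Perm (Fin (n + 1)), ∑ x : Fin (n + 1) → Bool,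
    if associatedPartition (ofBinaryCode x) σ = π ∧ σ (Fin.last n) = a then
      ∏ i : Fin (n + 1), codeWeight θ i (x i) else 0

theorem lastPlaceSum_relabel {n : ℕ} (θ : ℝ≥0) (τ : Equiv.Perm (Fin (n + 1)))
    (π : SetPartition (n + 1)) (a : Fin (n + 1)) :
    lastPlaceSum θ (relabel τ π) (τ a) = lastPlaceSum θ π a := by
  classical
  rw [lastPlaceSum, lastPlaceSum, ← Equiv.sum_comp (Equiv.mulLeft τ)]
  simp [← relabel_associatedPartition, (relabel_injective τ).eq_iff]

open Classical in
theorem sum_ite_lastPlaceSum {n : ℕ} (θ : ℝ≥0) (π : SetPartition (n + 1))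
    (S : Fin (n + 1) → Prop) [DecidablePred S] :
    ∑ σ : Equiv.Perm (Fin (n + 1)), ∑ x : Fin (n + 1) → Bool,
      (if associatedPartition (ofBinaryCode x) σ = π ∧ S (σ (Fin.last n)) then
        ∏ i : Fin (n + 1), codeWeight θ i (x i) else 0) =
      ∑ a ∈ Finset.univ.filter S, lastPlaceSum θ π a := by
  simp only [lastPlaceSum]
  symm
  rw [Finset.sum_comm]
  refine Finset.sum_congr rfl fun σ _ => ?_
  rw [Finset.sum_comm]
  refine Finset.sum_congr rfl fun x _ => ?_
  by_cases h : associatedPartition (ofBinaryCode x) σ = π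
  · simp [h]
  · simp [h]

theorem sameBox_snoc_castSucc {n : ℕ} (x : Fin n → Bool) (b : Bool) (i j : Fin n) :
    SameBox (Fin.snoc x b : Fin (n + 1) → Bool) i.castSucc j.castSucc ↔ SameBox x i j := by
  wlog hij : i ≤ j generalizing i j
  · have := this j i (le_of_not_ge hij)
    simpa only [SameBox, min_comm, max_comm] using this
  have hij' : i.castSucc ≤ j.castSucc := hij
  simp only [SameBox, min_eq_left hij, max_eq_right hij, min_eq_left hij', max_eq_right hij']
  constructor
  · intro h k h1 h2
    simpa using h k.castSucc (by simpa using h1) (by simpa using h2)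
  · intro h k
    induction k using Fin.lastCases with
    | last => exact fun _ h2 => absurd h2 (Fin.castSucc_lt_last j).not_ge
    | cast k => simpa using h k

theorem sameBox_snoc_last {n : ℕ} (x : Fin (n + 1) → Bool) (b : Bool) (i : Fin (n + 1)) :
    SameBox (Fin.snoc x b : Fin (n + 1 + 1) → Bool) (Fin.last _) i.castSucc ↔
      b = false ∧ SameBox x (Fin.last n) i := by
  have h0 := (Fin.castSucc_lt_last i).le
  simp only [SameBox, min_eq_right h0, max_eq_left h0, min_eq_right (Fin.le_last i),
    max_eq_left (Fin.le_last i)]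
  constructor
  · intro h
    refine ⟨by simpa using h (Fin.last _) (Fin.castSucc_lt_last i) le_rfl, fun k h1 _ => ?_⟩
    simpa using h k.castSucc (by simpa using h1) (Fin.le_last _)
  · rintro ⟨hb, h⟩ k
    induction k using Fin.lastCases with
    | last => simpa using hb
    | cast k => exact fun h1 _ => by simpa using h k (by simpa using h1) (Fin.le_last k)

theorem eq_iff_restrict_eq {n : ℕ} (h : n ≤ n + 1) {π ρ : SetPartition (n + 1)} :
    π = ρ ↔ restrict h π = restrict h ρ ∧
      ∀ a : Fin n, a.castSucc ∈ π.part (Fin.last n) ↔ a.castSucc ∈ ρ.part (Fin.last n) := by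
  constructor
  · rintro rfl
    simp
  · rintro ⟨h1, h2⟩
    have hsymm : ∀ (π : SetPartition (n + 1)) a b, a ∈ π.part b ↔ b ∈ π.part a := fun π a b => by
      rw [mem_part_iff_part_eq, mem_part_iff_part_eq, eq_comm]
    have hself : ∀ (π : SetPartition (n + 1)) a, a ∈ π.part a := fun π a =>
      π.mem_part (Finset.mem_univ a)
    refine setPartition_ext fun a b => ?_
    induction a using Fin.lastCases with
    | last =>
      induction b using Fin.lastCases with
      | last => simp [hself]
      | cast b => exact h2 b
    | cast a =>
      induction b using Fin.lastCases with
      | last => rw [hsymm, h2, hsymm]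
      | cast b => rw [← mem_part_restrict_succ h, h1, mem_part_restrict_succ]

/-- The last place can be added in two ways: if its number is alone in its block, the last symbol
is `1`; otherwise the symbol is `0`, and the number at the preceding place is in the same block. -/
theorem associatedPartition_snoc_eq_iff {n : ℕ} (h : n + 1 ≤ n + 1 + 1) (x : Fin (n + 1) → Bool)
    (b : Bool) (τ : Equiv.Perm (Fin (n + 1))) (π : SetPartition (n + 1 + 1)) :
    associatedPartition (ofBinaryCode (Fin.snoc x b : Fin (n + 1 + 1) → Bool))
        (insertPlace (Fin.last _) τ) = π ↔
      associatedPartition (ofBinaryCode x) τ = restrict h π ∧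
        if rankInBlock π (Fin.last _) = 0 then b = true
        else b = false ∧ (τ (Fin.last n)).castSucc ∈ π.part (Fin.last _) := by
  have hrestr : restrict h (associatedPartition
      (ofBinaryCode (Fin.snoc x b : Fin (n + 1 + 1) → Bool)) (insertPlace (Fin.last _) τ)) =
      associatedPartition (ofBinaryCode x) τ :=
    setPartition_ext fun a c => by
      simp only [mem_part_restrict_succ, mem_part_associatedPartition, insertPlace_symm_castSucc,
        Fin.succAbove_last, sameBox_snoc_castSucc]
  rw [eq_iff_restrict_eq h, hrestr]
  refine and_congr_right fun hρ => ?_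
  have hbox : ∀ a : Fin (n + 1),
      SameBox x (Fin.last n) (τ.symm a) ↔ a.castSucc ∈ π.part (τ (Fin.last n)).castSucc := by
    intro a
    rw [← mem_part_restrict_succ h, ← hρ, mem_part_associatedPartition, Equiv.symm_apply_apply]
  simp only [mem_part_associatedPartition, insertPlace_symm_castSucc, insertPlace_symm_last,
    Fin.succAbove_last, sameBox_snoc_last, hbox]
  have hrank : rankInBlock π (Fin.last _) = 0 ↔
      ∀ a : Fin (n + 1), a.castSucc ∉ π.part (Fin.last _) := by
    rw [rankInBlock, Finset.card_eq_zero, Finset.filter_eq_empty_iff]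
    simp [Fin.forall_fin_succ']
  have hself := π.mem_part (Finset.mem_univ (τ (Fin.last n)).castSucc)
  split_ifs with h0
  · rw [hrank] at h0
    constructor
    · intro hall
      by_contra hb
      exact h0 (τ (Fin.last n)) ((hall _).1 ⟨by simpa using hb, hself⟩)
    · rintro rfl a
      simp [h0 a]
  · rw [hrank] at h0
    push Not at h0
    obtain ⟨a, ha⟩ := h0
    constructor
    · intro hall
      have hb := ((hall a).2 ha).1
      exact ⟨hb, (hall _).1 ⟨hb, hself⟩⟩
    · rintro ⟨hb, hτ⟩ c
      rw [mem_part_iff_part_eq] at hτ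
      rw [hτ]
      simp [hb]

theorem sum_bool_succ {n : ℕ} {M : Type*} [AddCommMonoid M] (f : (Fin (n + 1) → Bool) → M) :
    ∑ x, f x = ∑ x : Fin n → Bool, ∑ b, f (Fin.snoc x b : Fin (n + 1) → Bool) := by
  rw [← Equiv.sum_comp (Fin.snocEquiv fun _ => Bool) f, Fintype.sum_prod_type, Finset.sum_comm]
  rfl

theorem lastPlaceSum_last_succ {n : ℕ} (θ : ℝ≥0) (h : n + 1 ≤ n + 1 + 1)
    (π : SetPartition (n + 1 + 1)) :
    lastPlaceSum θ π (Fin.last _) =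
      if rankInBlock π (Fin.last _) = 0 then
        codeWeight θ (n + 1) true * ∑ a, lastPlaceSum θ (restrict h π) a
      else codeWeight θ (n + 1) false *
        ∑ a ∈ Finset.univ.filter fun a : Fin (n + 1) => a.castSucc ∈ π.part (Fin.last _),
          lastPlaceSum θ (restrict h π) a := by
  classical
  -- the last place has the largest number only if it is the place that is inserted
  rw [lastPlaceSum, sum_perm_succ, Finset.sum_eq_single (Fin.last _)]
  rotate_left
  · intro p _ hp
    refine Finset.sum_eq_zero fun τ _ => Finset.sum_eq_zero fun x _ => if_neg ?_
    rintro ⟨-, hlast⟩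
    rw [← Equiv.eq_symm_apply, insertPlace_symm_last] at hlast
    exact hp hlast.symm
  · simp
  simp only [sum_bool_succ (n := n + 1), insertPlace_self, and_true,
    associatedPartition_snoc_eq_iff h, Fin.prod_univ_castSucc (n := n + 1), Fin.snoc_castSucc,
    Fin.snoc_last, Fin.val_castSucc, Fin.val_last, Fintype.sum_bool]
  split_ifs with h0
  · have := sum_ite_lastPlaceSum θ (restrict h π) fun _ => True
    simp only [and_true, Finset.filter_true] at this
    rw [← this, Finset.mul_sum]
    simp [Finset.mul_sum, mul_comm]
  · rw [← sum_ite_lastPlaceSum θ (restrict h π)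
      fun a => a.castSucc ∈ π.part (Fin.last _), Finset.mul_sum]
    simp [Finset.mul_sum, mul_comm]

/-- The number at the last place is uniformly distributed and independent of the partition, which
has the Ewens distribution. -/
theorem lastPlaceSum_eq {n : ℕ} (θ : ℝ≥0) (π : SetPartition (n + 1)) (a : Fin (n + 1)) :
    lastPlaceSum θ π a = n.factorial * ewensProb θ π := by
  induction n with
  | zero =>
    have h1 : ∀ (σ : Equiv.Perm (Fin (0 + 1))) (x : Fin (0 + 1) → Bool),
        associatedPartition (ofBinaryCode x) σ = π := fun σ x =>
      setPartition_ext fun a b => by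
        obtain rfl : a = b := Subsingleton.elim (α := Fin 1) a b
        simp only [Finpartition.mem_part, Finset.mem_univ]
    obtain rfl : a = 0 := Subsingleton.elim (α := Fin 1) a 0
    rw [ewensProb_one, lastPlaceSum, sum_perm_succ]
    simp only [h1, sum_bool_succ]
    simp [codeWeight_zero, Fin.snoc]
  | succ n ih =>
    wlog ha : a = Fin.last _ generalizing a π
    · have := this (relabel (Equiv.swap a (Fin.last _)) π) (Equiv.swap a (Fin.last _) a) (by simp)
      rwa [lastPlaceSum_relabel, ewensProb_relabel] at this
    have h : n + 1 ≤ n + 1 + 1 := Nat.le_succ _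
    have hcard : (Finset.univ.filter fun a : Fin (n + 1) =>
        a.castSucc ∈ π.part (Fin.last _)).card = rankInBlock π (Fin.last _) := by
      rw [rankInBlock, ← Finset.card_map (Fin.castSuccEmb (n := n + 1))]
      congr 1
      ext b
      induction b using Fin.lastCases <;> simp [Fin.castSucc_lt_last, (Fin.castSucc_lt_last _).ne]
    have hpos : (θ : ℝ) + (n + 1) ≠ 0 := by positivity
    rw [ha, lastPlaceSum_last_succ θ h, ewensProb_succ θ h]
    simp only [ih, Finset.sum_const, hcard, Finset.card_univ, Fintype.card_fin, codeWeight,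
      Nat.factorial_succ, nsmul_eq_mul]
    push_cast
    split_ifs <;> simp_all <;> field_simp

/-! ### Merging two independent marks -/

/-- The probability that the mark of the place `i`, counted from `0` and replaced by `0` if it is
negative, exceeds `x`. -/
noncomputable def markTail (i : ℕ) (x : ℝ) : ℝ :=
  if x < 0 then 1 else i / (x + i)

/-- The partial fraction identity behind consistency: the tail of the minimum of two successive
marks is a combination of their tails, and the coefficients telescope in `i`. -/
theorem markTail_mul_markTail_succ (i : ℕ) (x : ℝ) :
    markTail i x * markTail (i + 1) x = (i + 1) * markTail i x - i * markTail (i + 1) x := by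
  unfold markTail
  split_ifs with hx
  · ring
  · rcases Nat.eq_zero_or_pos i with rfl | hi
    · simp
    · have hi' : (0 : ℝ) < i := by exact_mod_cast hi
      have h1 : x + i ≠ 0 := by linarith
      have h2 : x + (i + 1) ≠ 0 := by linarith
      push_cast
      field_simp
      ring

/-- The tail, at the place `q`, of the marks that remain when the place `p` is removed. -/
noncomputable def mergedTail (p q : ℕ) (x : ℝ) : ℝ :=
  if q < p then markTail q x
  else if q = p then markTail q x * markTail (q + 1) x else markTail (q + 1) x

theorem prod_mergedTail_of_le {n p : ℕ} (h : n ≤ p) (x : ℕ → ℝ) :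
    ∏ q ∈ Finset.range n, mergedTail p q (x q) = ∏ q ∈ Finset.range n, markTail q (x q) :=
  Finset.prod_congr rfl fun _ hq => if_pos ((Finset.mem_range.1 hq).trans_le h)

theorem sum_prod_mergedTail (n : ℕ) (x : ℕ → ℝ) :
    ∑ p ∈ Finset.range (n + 1), ∏ q ∈ Finset.range n, mergedTail p q (x q) =
      (n + 1) * ∏ q ∈ Finset.range n, markTail q (x q) := by
  induction n with
  | zero => simp
  | succ n ih =>
    rw [Finset.sum_range_succ, prod_mergedTail_of_le le_rfl, Finset.sum_range_succ]
    rw [Finset.sum_range_succ, prod_mergedTail_of_le le_rfl] at ih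
    have h1 : ∑ p ∈ Finset.range n, ∏ q ∈ Finset.range (n + 1), mergedTail p q (x q) =
        (∑ p ∈ Finset.range n, ∏ q ∈ Finset.range n, mergedTail p q (x q)) *
          markTail (n + 1) (x n) := by
      rw [Finset.sum_mul]
      refine Finset.sum_congr rfl fun p hp => ?_
      have hp := Finset.mem_range.1 hp
      rw [Finset.prod_range_succ, mergedTail, if_neg hp.not_gt, if_neg hp.ne']
    have h2 : mergedTail n n (x n) = markTail n (x n) * markTail (n + 1) (x n) := by
      simp [mergedTail]
    rw [h1, Finset.prod_range_succ, prod_mergedTail_of_le le_rfl, h2, Finset.prod_range_succ,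
      eq_sub_of_add_eq ih, markTail_mul_markTail_succ]
    push_cast
    ring

/-- The left-hand side lists the tails by the original places, the right-hand side by the places
that remain. The correction factor is the tail at the place `m`, which shares its argument with the
place before it once `p < m`. -/
theorem prod_mergedTail_eq (p m : ℕ) (x : ℕ → ℝ) :
    (∏ k ∈ Finset.range m, if k ≤ p then markTail k (x k) else markTail k (x (k - 1))) *
      (if m ≤ p then 1 else markTail m (x (m - 1))) =
      ∏ q ∈ Finset.range m, mergedTail p q (x q) := by
  induction m with
  | zero => simp
  | succ m ih =>
    rw [Finset.prod_range_succ, Finset.prod_range_succ, ← ih, Nat.add_sub_cancel, mergedTail]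
    rcases lt_trichotomy m p with h | rfl | h
    · rw [if_pos h.le, if_pos (Nat.succ_le_of_lt h), if_pos h.le, if_pos h]
      ring
    · simp
      ring
    · rw [if_neg h.not_ge, if_neg (by omega : ¬ m + 1 ≤ p), if_neg h.not_ge, if_neg h.not_gt,
        if_neg h.ne']

theorem measurable_mergeAt {n : ℕ} (p : Fin (n + 1)) :
    Measurable (mergeAt p : (Fin (n + 1) → ℝ) → Fin n → ℝ) := by
  refine measurable_pi_iff.2 fun q => ?_
  unfold mergeAt
  split_ifs <;> fun_prop

theorem pi_real_mergeAt {ν : ℕ → Measure ℝ} [∀ i, IsProbabilityMeasure (ν i)]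
    (hν : ∀ i x, (ν i).real (Set.Ioi x) = markTail i x) {n : ℕ} (p : Fin (n + 1)) (x : ℕ → ℝ) :
    (Measure.pi fun i : Fin (n + 1) => ν i).real
        (mergeAt p ⁻¹' Set.univ.pi fun q : Fin n => Set.Ioi (x q)) =
      ∏ q ∈ Finset.range n, mergedTail p q (x q) := by
  -- a place after `p` has to satisfy the constraint of its predecessor; the last place is
  -- unconstrained if it is the one removed
  have hset : (mergeAt p ⁻¹' Set.univ.pi fun q : Fin n => Set.Ioi (x q)) =
      Set.univ.pi fun k : Fin (n + 1) => if (k : ℕ) ≤ p then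
        (if (k : ℕ) < n then Set.Ioi (x k) else Set.univ) else Set.Ioi (x (k - 1)) := by
    ext t
    simp only [Set.mem_preimage, Set.mem_univ_pi, Set.mem_Ioi]
    constructor
    · intro h k
      split_ifs with h1 h2
      · have := h ⟨k, h2⟩
        simp only [mergeAt, Fin.lt_def, Fin.ext_iff, Fin.val_castSucc] at this
        split_ifs at this with h3 h4
        · exact this
        · exact (lt_min_iff.1 this).1
        · omega
      · trivial
      · have hk := k.isLt
        have := h ⟨k - 1, by omega⟩
        have hs : (⟨k - 1, by omega⟩ : Fin n).succ = k := Fin.ext (by simp; omega)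
        simp only [mergeAt, Fin.lt_def, Fin.ext_iff, Fin.val_castSucc, hs] at this
        split_ifs at this with h3 h4
        · omega
        · exact (lt_min_iff.1 this).2
        · exact this
    · intro h q
      have h1 := h q.castSucc
      have h2 := h q.succ
      simp only [Fin.val_castSucc, Fin.val_succ, q.isLt, if_true, Nat.add_sub_cancel] at h1 h2
      simp only [mergeAt, Fin.lt_def, Fin.ext_iff, Fin.val_castSucc]
      split_ifs with h3 h4
      · rwa [if_pos h3.le] at h1
      · rw [if_pos h4.le] at h1
        rw [if_neg (by omega)] at h2
        exact lt_min h1 h2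
      · rwa [if_neg (by omega)] at h2
  rw [hset, measureReal_def, Measure.pi_pi, ENNReal.toReal_prod, ← prod_mergedTail_eq]
  have hfac : ∀ k : Fin (n + 1), ((ν k) (if (k : ℕ) ≤ p then
      (if (k : ℕ) < n then Set.Ioi (x k) else Set.univ) else Set.Ioi (x (k - 1)))).toReal =
      (fun k : ℕ => if k ≤ p then (if k < n then markTail k (x k) else 1)
        else markTail k (x (k - 1))) k := by
    intro k
    simp only [← measureReal_def]
    split_ifs <;> simp [hν]
  rw [Finset.prod_congr rfl fun k _ => hfac k, Fin.prod_univ_eq_prod_range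
    (fun k : ℕ => if k ≤ p then (if k < n then markTail k (x k) else 1)
      else markTail k (x (k - 1))) (n + 1), Finset.prod_range_succ]
  congr 1
  · refine Finset.prod_congr rfl fun k hk => ?_
    rw [if_pos (Finset.mem_range.1 hk)]
  · simp

/-- Removing a uniformly chosen place and merging its mark with the next one turns the marks of
`n + 1` places into the marks of `n` places, in law. -/
theorem sum_map_mergeAt {ν : ℕ → Measure ℝ} [∀ i, IsProbabilityMeasure (ν i)]
    (hν : ∀ i x, (ν i).real (Set.Ioi x) = markTail i x) (n : ℕ) :
    ∑ p : Fin (n + 1), (Measure.pi fun i : Fin (n + 1) => ν i).map (mergeAt p) =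
      ((n + 1 : ℕ) : ENNReal) • Measure.pi fun i : Fin n => ν i := by
  have hne : ((n + 1 : ℕ) : ENNReal) ≠ 0 := by simp
  have hnt : ((n + 1 : ℕ) : ENNReal) ≠ ⊤ := ENNReal.natCast_ne_top _
  have hpi : (Measure.pi fun i : Fin n => ν i) = ((n + 1 : ℕ) : ENNReal)⁻¹ •
      ∑ p : Fin (n + 1), (Measure.pi fun i : Fin (n + 1) => ν i).map (mergeAt p) := by
    refine Measure.pi_eq_generateFrom (C := fun _ => Set.range Set.Ioi)
      (fun _ => (borel_eq_generateFrom_Ioi ℝ).symm.trans (BorelSpace.measurable_eq).symm)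
      (fun _ => isPiSystem_Ioi) (fun i =>
        { set := fun k => Set.Ioi (-(k : ℝ))
          set_mem := fun k => ⟨_, rfl⟩
          finite := fun k => measure_lt_top _ _
          spanning := Set.eq_univ_of_forall fun u => by
            obtain ⟨k, hk⟩ := exists_nat_gt (-u)
            exact Set.mem_iUnion.2 ⟨k, by simp only [Set.mem_Ioi]; linarith⟩ }) fun s hs => ?_
    choose y hy using hs
    let x : ℕ → ℝ := fun k => if h : k < n then y ⟨k, h⟩ else 0
    obtain rfl : s = fun q : Fin n => Set.Ioi (x q) := by
      funext q
      simp [x, ← hy]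
    have hmeas : MeasurableSet (Set.univ.pi fun q : Fin n => Set.Ioi (x q)) :=
      MeasurableSet.univ_pi fun _ => measurableSet_Ioi
    simp only [Measure.smul_apply, Measure.finsetSum_apply, smul_eq_mul,
      Measure.map_apply (measurable_mergeAt _) hmeas]
    refine (ENNReal.toReal_eq_toReal_iff' ?_ ?_).1 ?_
    · exact ENNReal.mul_ne_top (ENNReal.inv_ne_top.2 hne)
        (ENNReal.sum_ne_top.2 fun p _ => measure_ne_top _ _)
    · exact ENNReal.prod_ne_top fun i _ => measure_ne_top _ _
    · rw [ENNReal.toReal_mul, ENNReal.toReal_inv, ENNReal.toReal_natCast,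
        ENNReal.toReal_sum fun p _ => measure_ne_top _ _, ENNReal.toReal_prod]
      simp only [← measureReal_def, pi_real_mergeAt hν, hν]
      rw [Fin.sum_univ_eq_sum_range fun p => ∏ q ∈ Finset.range n, mergedTail p q (x q),
        sum_prod_mergedTail, Fin.prod_univ_eq_prod_range fun q => markTail q (x q)]
      push_cast
      field_simp
  rw [hpi, smul_smul, ENNReal.mul_inv_cancel hne hnt, one_smul]

/-! ### The law of the fragmentation process -/

/-- The uniform distribution on the permutations of `[n]`. -/
noncomputable def uniformPerm (n : ℕ) : Measure (Equiv.Perm (Fin n)) :=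
  (n.factorial : ENNReal)⁻¹ • Measure.count

instance (n : ℕ) : DiscreteMeasurableSpace (Equiv.Perm (Fin n)) := ⟨fun _ => trivial⟩

instance (n : ℕ) : DiscreteMeasurableSpace (SetPartition n) := ⟨fun _ => trivial⟩

instance (n : ℕ) : DiscreteMeasurableSpace (Composition n) := ⟨fun _ => trivial⟩

instance (n : ℕ) : IsFiniteMeasure (uniformPerm n) :=
  ⟨by
    rw [uniformPerm, Measure.smul_apply, smul_eq_mul]
    exact ENNReal.mul_lt_top (ENNReal.inv_lt_top.2 (by exact_mod_cast n.factorial_pos))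
      (measure_lt_top _ _)⟩

theorem uniformPerm_prod_apply {n : ℕ} {α : Type*} [MeasurableSpace α] (μ : Measure α)
    [IsFiniteMeasure μ] {E : Set (Equiv.Perm (Fin n) × α)} (hE : MeasurableSet E) :
    (uniformPerm n).prod μ E = (n.factorial : ENNReal)⁻¹ * ∑ σ, μ (Prod.mk σ ⁻¹' E) := by
  rw [Measure.prod_apply hE, uniformPerm, lintegral_smul_measure, lintegral_count, tsum_fintype,
    smul_eq_mul]

theorem measurable_code {n : ℕ} (θ : ℝ≥0) :
    Measurable fun (t : Fin n → ℝ) (i : Fin n) => decide (t i ≤ θ) := by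
  refine measurable_pi_iff.2 fun i => measurable_to_bool ?_
  have : (fun t : Fin n → ℝ => decide (t i ≤ (θ : ℝ))) ⁻¹' {true} = {t | t i ≤ (θ : ℝ)} := by
    ext t
    simp
  rw [this]
  exact measurableSet_le (measurable_pi_apply i) measurable_const

theorem measurable_associatedPartition (n : ℕ) :
    Measurable fun (q : Equiv.Perm (Fin n) × (ℝ≥0 → Composition n)) (θ : ℝ≥0) =>
      associatedPartition (q.2 θ) q.1 := by
  refine measurable_pi_iff.2 fun θ => ?_
  have h1 : Measurable fun q : Equiv.Perm (Fin n) × Composition n =>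
      associatedPartition q.2 q.1 := measurable_of_countable _
  have h2 : Measurable fun q : Equiv.Perm (Fin n) × (ℝ≥0 → Composition n) => (q.1, q.2 θ) :=
    measurable_fst.prodMk ((measurable_pi_apply θ).comp measurable_snd)
  have h := h1.comp h2
  simp only [Function.comp_def] at h
  exact h

/-- The composition process with given marks of the places. -/
noncomputable def thresholdComposition {n : ℕ} (t : Fin n → ℝ) (θ : ℝ≥0) : Composition n :=
  ofBinaryCode fun i => decide (t i ≤ θ)

theorem measurable_thresholdComposition (n : ℕ) :
    Measurable (thresholdComposition : (Fin n → ℝ) → ℝ≥0 → Composition n) :=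
  measurable_pi_iff.2 fun θ =>
    (Measurable.of_discrete (f := fun x : Fin n → Bool => ofBinaryCode x)).comp (measurable_code θ)

theorem measurable_thresholdPartition (n : ℕ) :
    Measurable fun (q : Equiv.Perm (Fin n) × (Fin n → ℝ)) (θ : ℝ≥0) =>
      thresholdPartition q.1 q.2 θ := by
  have h := (measurable_associatedPartition n).comp
    (measurable_id.prodMap (measurable_thresholdComposition n))
  simp only [Function.comp_def, Prod.map] at h
  exact h

/-- A map between spaces of partitions, applied at every level, is measurable on processes. -/
theorem measurable_comp_process {n m : ℕ} (f : SetPartition n → SetPartition m) :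
    Measurable fun (X : ℝ≥0 → SetPartition n) (θ : ℝ≥0) => f (X θ) :=
  measurable_pi_iff.2 fun θ => (Measurable.of_discrete (f := f)).comp (measurable_pi_apply θ)

/-- The law of the fragmentation process of `[n]`: the numbering of the places is uniform, and the
marks of the places are independent of it and have the law `⨂ ν i`. -/
noncomputable def fragmentationLaw (ν : ℕ → Measure ℝ) (n : ℕ) : Measure (ℝ≥0 → SetPartition n) :=
  ((uniformPerm n).prod (Measure.pi fun i : Fin n => ν i)).map
    fun q θ => thresholdPartition q.1 q.2 θ

section

variable {ν : ℕ → Measure ℝ} [∀ i, IsProbabilityMeasure (ν i)]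

/-- Only the composition process has to be independent of the numbering of the places. -/
theorem map_associatedPartition_prod (n : ℕ) :
    ((uniformPerm n).prod ((Measure.pi fun i : Fin n => ν i).map thresholdComposition)).map
      (fun q θ => associatedPartition (q.2 θ) q.1) = fragmentationLaw ν n := by
  have hid : (uniformPerm n).map id = uniformPerm n := Measure.map_id
  have hI := measurable_thresholdComposition n
  rw [← hid, Measure.map_prod_map _ _ measurable_id hI,
    Measure.map_map (measurable_associatedPartition n) (measurable_id.prodMap hI),
    fragmentationLaw]
  rfl

theorem fragmentationLaw_apply {n : ℕ} {S : Set (ℝ≥0 → SetPartition n)} (hS : MeasurableSet S) :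
    fragmentationLaw ν n S = (n.factorial : ENNReal)⁻¹ * ∑ σ : Equiv.Perm (Fin n),
      (Measure.pi fun i : Fin n => ν i) {t | (fun θ => thresholdPartition σ t θ) ∈ S} := by
  rw [fragmentationLaw, Measure.map_apply (measurable_thresholdPartition n) hS,
    uniformPerm_prod_apply _ (measurable_thresholdPartition n hS)]
  rfl

theorem map_relabel_fragmentationLaw {n : ℕ} (τ : Equiv.Perm (Fin n)) :
    (fragmentationLaw ν n).map (fun X θ => relabel τ (X θ)) = fragmentationLaw ν n := by
  ext S hS
  have hf := measurable_comp_process (relabel τ)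
  rw [Measure.map_apply hf hS, fragmentationLaw_apply (hf hS), fragmentationLaw_apply hS]
  conv_rhs => rw [← Equiv.sum_comp (Equiv.mulLeft τ)]
  simp only [Set.mem_preimage, thresholdPartition, relabel_associatedPartition,
    Equiv.coe_mulLeft]

theorem map_restrict_succ_fragmentationLaw
    (hν : ∀ i x, (ν i).real (Set.Ioi x) = markTail i x) {n : ℕ} (h : n ≤ n + 1) :
    (fragmentationLaw ν (n + 1)).map (fun X θ => restrict h (X θ)) = fragmentationLaw ν n := by
  ext S hS
  have hf := measurable_comp_process (restrict h)
  rw [Measure.map_apply hf hS, fragmentationLaw_apply (hf hS), fragmentationLaw_apply hS,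
    sum_perm_succ, Finset.sum_comm]
  have key : ∀ τ : Equiv.Perm (Fin n), ∑ p : Fin (n + 1),
      (Measure.pi fun i : Fin (n + 1) => ν i)
        {t | (fun θ => thresholdPartition (insertPlace p τ) t θ) ∈
          (fun (X : ℝ≥0 → SetPartition (n + 1)) θ => restrict h (X θ)) ⁻¹' S} =
      ((n + 1 : ℕ) : ENNReal) *
        (Measure.pi fun i : Fin n => ν i) {t | (fun θ => thresholdPartition τ t θ) ∈ S} := by
    intro τ
    have hE : MeasurableSet {t : Fin n → ℝ | (fun θ => thresholdPartition τ t θ) ∈ S} :=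
      ((measurable_thresholdPartition n).comp (measurable_prodMk_left (x := τ))) hS
    have := congrArg (fun μ : Measure (Fin n → ℝ) =>
      μ {t | (fun θ => thresholdPartition τ t θ) ∈ S}) (sum_map_mergeAt hν n)
    simp only [Measure.finsetSum_apply, Measure.map_apply (measurable_mergeAt _) hE,
      Measure.smul_apply, smul_eq_mul] at this
    simp only [Set.mem_preimage, restrict_thresholdPartition_insertPlace]
    exact this
  have hne : ((n + 1 : ℕ) : ENNReal) ≠ 0 := by simp
  have hnt : ((n + 1 : ℕ) : ENNReal) ≠ ⊤ := ENNReal.natCast_ne_top _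
  rw [Finset.sum_congr rfl fun τ _ => key τ, ← Finset.mul_sum, ← mul_assoc, Nat.factorial_succ,
    Nat.cast_mul, ENNReal.mul_inv (Or.inl hne) (Or.inl hnt), mul_comm _⁻¹ (_⁻¹), mul_assoc _⁻¹,
    ENNReal.inv_mul_cancel hne hnt, mul_one]

theorem map_restrict_fragmentationLaw
    (hν : ∀ i x, (ν i).real (Set.Ioi x) = markTail i x) {n m : ℕ} (h : n ≤ m) :
    (fragmentationLaw ν m).map (fun X θ => restrict h (X θ)) = fragmentationLaw ν n := by
  induction m, h using Nat.le_induction with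
  | base =>
    have : (fun (X : ℝ≥0 → SetPartition n) θ => restrict le_rfl (X θ)) = id := by
      funext X θ
      exact setPartition_ext fun a b => mem_part_pullback _ _ a b
    rw [this, Measure.map_id]
  | succ m h ih =>
    conv_rhs => rw [← ih, ← map_restrict_succ_fragmentationLaw hν m.le_succ]
    rw [Measure.map_map (measurable_comp_process _) (measurable_comp_process _)]
    congr 1
    funext X θ
    exact (restrict_restrict h m.le_succ (X θ)).symm

theorem pi_real_code_eq (hν : ∀ i x, (ν i).real (Set.Ioi x) = markTail i x) {n : ℕ} (θ : ℝ≥0)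
    (x : Fin n → Bool) :
    (Measure.pi fun i : Fin n => ν i).real ((fun t i => decide (t i ≤ θ)) ⁻¹' {x}) =
      ∏ i : Fin n, codeWeight θ i (x i) := by
  have hset : ((fun (t : Fin n → ℝ) i => decide (t i ≤ θ)) ⁻¹' {x}) =
      Set.univ.pi fun i => if x i then Set.Iic (θ : ℝ) else Set.Ioi (θ : ℝ) := by
    ext t
    simp only [Set.mem_preimage, Set.mem_singleton_iff, funext_iff, Set.mem_univ_pi]
    refine forall_congr' fun i => ?_
    cases x i <;> simp
  rw [hset, measureReal_def, Measure.pi_pi, ENNReal.toReal_prod]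
  refine Finset.prod_congr rfl fun i _ => ?_
  have hpos : ¬ (θ : ℝ) < 0 := θ.2.not_gt
  have hIoi : (ν i).real (Set.Ioi (θ : ℝ)) = (i : ℕ) / (θ + (i : ℕ)) := by
    rw [hν, markTail, if_neg hpos]
  rw [← measureReal_def]
  cases x i
  · simpa [codeWeight] using hIoi
  · rw [if_pos rfl, ← Set.compl_Ioi, probReal_compl_eq_one_sub measurableSet_Ioi, hIoi, codeWeight,
      if_pos rfl]
    split_ifs with h0
    · simp [h0]
    · field_simp
      ring

theorem fragmentationLaw_real_eval_eq (hν : ∀ i x, (ν i).real (Set.Ioi x) = markTail i x)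
    {n : ℕ} (θ : ℝ≥0) (π : SetPartition (n + 1)) :
    (fragmentationLaw ν (n + 1)).real {X | X θ = π} = ewensProb θ π := by
  classical
  have hS : MeasurableSet {X : ℝ≥0 → SetPartition (n + 1) | X θ = π} :=
    (measurable_pi_apply θ : Measurable fun X : ℝ≥0 → SetPartition (n + 1) => X θ)
      (MeasurableSet.of_discrete (s := {π}))
  have hσ : ∀ σ : Equiv.Perm (Fin (n + 1)),
      ((Measure.pi fun i : Fin (n + 1) => ν i)
        {t | (fun θ => thresholdPartition σ t θ) ∈
          {X : ℝ≥0 → SetPartition (n + 1) | X θ = π}}).toReal =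
      ∑ x : Fin (n + 1) → Bool, if associatedPartition (ofBinaryCode x) σ = π then
        ∏ i : Fin (n + 1), codeWeight θ i (x i) else 0 := by
    intro σ
    have hset : {t | (fun θ => thresholdPartition σ t θ) ∈
          {X : ℝ≥0 → SetPartition (n + 1) | X θ = π}} =
        (fun (t : Fin (n + 1) → ℝ) i => decide (t i ≤ θ)) ⁻¹'
          (Finset.univ.filter fun x => associatedPartition (ofBinaryCode x) σ = π : Finset _) := by
      ext t
      simp [thresholdPartition]
    rw [hset, ← measureReal_def, ← Finset.sum_filter, ← map_measureReal_apply (measurable_code θ)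
      (Finset.measurableSet _), ← sum_measureReal_singleton]
    refine Finset.sum_congr rfl fun x _ => ?_
    rw [map_measureReal_apply (measurable_code θ) (measurableSet_singleton x), pi_real_code_eq hν]
  rw [measureReal_def, fragmentationLaw_apply hS, ENNReal.toReal_mul, ENNReal.toReal_inv,
    ENNReal.toReal_natCast, ENNReal.toReal_sum fun σ _ => measure_ne_top _ _,
    Finset.sum_congr rfl fun σ _ => hσ σ]
  have := sum_ite_lastPlaceSum θ π fun _ => True
  simp only [and_true, Finset.filter_true, lastPlaceSum_eq, Finset.sum_const, Finset.card_univ,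
    Fintype.card_fin, nsmul_eq_mul] at this
  have hfac : ((n.factorial : ℕ) : ℝ) ≠ 0 := by exact_mod_cast n.factorial_ne_zero
  have hn : (n : ℝ) + 1 ≠ 0 := by positivity
  calc _ = ((n + 1).factorial : ℝ)⁻¹ * (((n + 1 : ℕ) : ℝ) * (n.factorial * ewensProb θ π)) := by
        rw [← this]
    _ = ewensProb θ π := by
        rw [Nat.factorial_succ]
        push_cast
        field_simp

end

end EwensFragmentation

/-! ### The four properties -/

open EwensFragmentation

theorem theorem1 {Ω : Type*} [MeasurableSpace Ω] (P : Measure Ω) [IsProbabilityMeasure P]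
    -- independent variables `Θ_j`, `j = 1, 2, …`, with `P(Θ_j ≤ θ) = θ / (θ + j - 1)`, `0 / 0 = 1`
    (Θ : ℕ+ → Ω → ℝ) (hΘ_meas : ∀ j, Measurable (Θ j)) (hΘ_indep : iIndepFun Θ P)
    (hΘ_law : ∀ (j : ℕ+) (θ : ℝ≥0), P.real {ω | Θ j ω ≤ θ} =
      if (θ : ℝ) + (j : ℝ) - 1 = 0 then 1 else (θ : ℝ) / ((θ : ℝ) + (j : ℝ) - 1))
    -- the compositions with binary codes `(1(Θ_j ≤ θ))_{j ≤ n}`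
    (C : (n : ℕ) → ℝ≥0 → Ω → Composition n)
    (hC : ∀ n θ ω, C n θ ω = EwensFragmentation.indicatorComposition n θ (fun j => Θ j ω))
    -- for every `n`, a uniform random permutation of `[n]` independent of `(C_{n,θ}, θ ≥ 0)`
    (σ : (n : ℕ) → Ω → Equiv.Perm (Fin n)) (hσ_meas : ∀ n, Measurable (σ n))
    (hσ_unif : ∀ (n : ℕ) (τ : Equiv.Perm (Fin n)),
      P.real {ω | σ n ω = τ} = 1 / (n.factorial : ℝ))
    (hσ_indep : ∀ n, IndepFun (σ n) (fun ω θ => C n θ ω) P) :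
    EwensFragmentation.IsEwensFragmentationFamily P
      (fun n θ ω => EwensFragmentation.associatedPartition (C n θ ω) (σ n ω)) := by
  -- negative values of the marks are irrelevant at the levels `θ ≥ 0`
  let T : ℕ → Ω → ℝ := fun i ω => max (Θ (Nat.succPNat i) ω) 0
  have hT_meas : ∀ i, Measurable (T i) := fun i => (hΘ_meas _).max measurable_const
  let ν : ℕ → Measure ℝ := fun i => P.map (T i)
  have hprob : ∀ i, IsProbabilityMeasure (ν i) := fun i =>
    Measure.isProbabilityMeasure_map (hT_meas i).aemeasurable
  have hν : ∀ i x, (ν i).real (Set.Ioi x) = markTail i x := by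
    intro i x
    rw [map_measureReal_apply (hT_meas i) measurableSet_Ioi, markTail]
    split_ifs with hx
    · have : T i ⁻¹' Set.Ioi x = Set.univ :=
        Set.eq_univ_of_forall fun ω => hx.trans_le (le_max_right _ _)
      rw [this, probReal_univ]
    · lift x to ℝ≥0 using not_lt.1 hx
      have hset : T i ⁻¹' Set.Ioi (x : ℝ) = {ω | Θ (Nat.succPNat i) ω ≤ x}ᶜ := by
        ext ω
        simp [T]
      rw [hset, probReal_compl_eq_one_sub (measurableSet_le (hΘ_meas _) measurable_const), hΘ_law]
      have hj : (((Nat.succPNat i : ℕ+) : ℕ) : ℝ) = i + 1 := by simp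
      simp only [hj, ← add_assoc, add_sub_cancel_right]
      split_ifs with h0
      · simp [h0]
      · field_simp
        ring
  -- the composition process is a measurable function of the marks
  have hvec : ∀ n, Measurable fun ω (i : Fin n) => T i ω := fun n =>
    measurable_pi_iff.2 fun i => hT_meas i
  have hCI : ∀ n, (fun ω θ => C n θ ω) = thresholdComposition ∘ fun ω (i : Fin n) => T i ω := by
    intro n
    funext ω θ
    simp only [hC, indicatorComposition, thresholdComposition, Function.comp_apply, T]
    congr 1
    funext i
    simp
  have hCmeas : ∀ n, Measurable fun ω θ => C n θ ω := fun n =>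
    hCI n ▸ (measurable_thresholdComposition n).comp (hvec n)
  have hX : ∀ n, Measurable fun ω θ => associatedPartition (C n θ ω) (σ n ω) := by
    intro n
    have h := (measurable_associatedPartition n).comp ((hσ_meas n).prodMk (hCmeas n))
    simp only [Function.comp_def] at h
    exact h
  have hσ_law : ∀ n, P.map (σ n) = uniformPerm n := by
    intro n
    refine Measure.ext_of_singleton fun τ => ?_
    rw [Measure.map_apply (hσ_meas n) (measurableSet_singleton τ), uniformPerm,
      Measure.smul_apply, Measure.count_singleton, smul_eq_mul, mul_one,
      ← ENNReal.toReal_eq_toReal_iff' (measure_ne_top _ _)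
        (ENNReal.inv_ne_top.2 (by exact_mod_cast n.factorial_ne_zero)),
      ENNReal.toReal_inv, ENNReal.toReal_natCast, ← one_div]
    exact hσ_unif n τ
  have hvec_law : ∀ n, P.map (fun ω (i : Fin n) => T i ω) = Measure.pi fun i : Fin n => ν i := by
    intro n
    have hinj : Function.Injective fun i : Fin n => Nat.succPNat i := fun i j h =>
      Fin.ext (Nat.succPNat_injective h)
    have hind : iIndepFun (fun (i : Fin n) => T i) P :=
      (hΘ_indep.precomp hinj).comp (fun _ u => max u 0) fun _ => measurable_id.max measurable_const
    exact (iIndepFun_iff_map_fun_eq_pi_map fun i : Fin n => (hT_meas i).aemeasurable).1 hind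
  have hlaw : ∀ n, P.map (fun ω θ => associatedPartition (C n θ ω) (σ n ω)) =
      fragmentationLaw ν n := by
    intro n
    have hjoint := (indepFun_iff_map_prod_eq_prod_map_map (hσ_meas n).aemeasurable
      (hCmeas n).aemeasurable).1 (hσ_indep n)
    have hC_law : P.map (fun ω θ => C n θ ω) =
        (Measure.pi fun i : Fin n => ν i).map thresholdComposition := by
      rw [hCI, ← Measure.map_map (measurable_thresholdComposition n) (hvec n), hvec_law]
    rw [hσ_law, hC_law] at hjoint
    rw [← map_associatedPartition_prod, ← hjoint, Measure.map_map
      (measurable_associatedPartition n) ((hσ_meas n).prodMk (hCmeas n))]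
    rfl
  refine ⟨fun n _ θ => (measurable_pi_apply θ).comp (hX n), ?_, ?_, ?_, ?_⟩
  · intro n hn θ π
    obtain ⟨n, rfl⟩ := Nat.exists_eq_add_of_le' hn
    have hS : MeasurableSet {X : ℝ≥0 → SetPartition (n + 1) | X θ = π} :=
      (measurable_pi_apply θ : Measurable fun X : ℝ≥0 → SetPartition (n + 1) => X θ)
        (MeasurableSet.of_discrete (s := {π}))
    rw [← fragmentationLaw_real_eval_eq hν θ π, ← hlaw, map_measureReal_apply (hX _) hS]
    rfl
  · intro n _ φ θ hφθ ω
    simp only [hC, indicatorComposition]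
    refine associatedPartition_mono (fun i hi => ?_) _
    simp only [decide_eq_true_eq] at hi ⊢
    exact hi.trans (NNReal.coe_le_coe.2 hφθ.le)
  · intro n m _ h
    have hf := measurable_comp_process (restrict h.le)
    refine ⟨(hf.comp (hX m)).aemeasurable, (hX n).aemeasurable, ?_⟩
    rw [hlaw, ← map_restrict_fragmentationLaw hν h.le, ← hlaw, Measure.map_map hf (hX m)]
    rfl
  · intro n _ τ
    have hf := measurable_comp_process (relabel τ)
    refine ⟨(hf.comp (hX n)).aemeasurable, (hX n).aemeasurable, ?_⟩
    conv_rhs => rw [hlaw, ← map_relabel_fragmentationLaw τ, ← hlaw, Measure.map_map hf (hX n)]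
    rfl
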